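/- For an integer $n\ge 1$ and a field $\mathbb F$, let $M_n(\mathbb F)$ be the set of $n\times n$ matrices over $\mathbb F$. For $A=(a_{ij})\in M_n(\mathbb F)$ let $\operatorname{per}A=\sum_{\sigma\in S_n}\prod_{i=1}^n a_{i\sigma(i)}$ be its permanent, and put $$P_n(\mathbb F)=\{A\in M_n(\mathbb F):\operatorname{per}A=0\},\qquad D_n(\mathbb F)=\{A\in M_n(\mathbb F):\det A=0\}.$$ **Theorem.** Let $n\ge 3$. Then there exists $q_0$, depending only on $n$, such that for every finite field $\mathbb F$ with $|\mathbb F|\ge q_0$ and $\operatorname{char}\mathbb F\ne 2$ the following hold: 1. no bijective map $\Phi:M_n(\mathbb F)\to M_n(\mathbb F)$ satisfies $\operatorname{per}A=\det\Phi(A)$ for all $A\in M_n(\mathbb F)$; 2. $|P_n(\mathbb F)|<|D_n(\mathbb F)|$. When $n=3$, both conclusions hold for every finite field $\mathbb F$ with $\operatorname{char}\mathbb F\ne 2$. -/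

import Mathlib

universe u

/-- The set `P_n(F)` of all `n × n` matrices over `F` with zero permanent. -/
def zeroPermanent (n : ℕ) (F : Type u) [Field F] : Set (Matrix (Fin n) (Fin n) F) :=
  {A | A.permanent = 0}

/-- The set `D_n(F)` of all `n × n` matrices over `F` with zero determinant. -/
def zeroDeterminant (n : ℕ) (F : Type u) [Field F] : Set (Matrix (Fin n) (Fin n) F) :=
  {A | A.det = 0}

/-! Let q = |F|. Read the rows of a matrix as linear forms in the algebra F[x_1,…,x_n]/(x_i²): the
coefficients of a product of k rows are the k × k subpermanents (`subPermanent`). The permanent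
vanishes iff the first row annihilates the product of the other n − 1 rows. If that product is
nonzero, at most q^(n-1) rows do so. Hence |P_n|/q^(n²) exceeds 1/q by at most (1 − 1/q) times the
proportion of (n − 1) × n matrices with zero product.

That proportion is O(q⁻³) for fixed n (`zeroCount_penultimate_le`). Over a nonzero product of n − 3
rows, the two remaining rows are governed by a symmetric 3 × 3 matrix with zero diagonal, whose
determinant 2abc is where characteristic ≠ 2 enters.

On the other side |D_n|/q^(n²) ≥ 1 − (1 − 1/q)(1 − 1/q²)(1 − 1/q³), which exceeds 1/q by about 1/q²
and so wins for large q (`ncard_zeroPermanent_lt`). A bijection carrying permanent to determinant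
would force |P_n| = |D_n|. -/

/-! ### Fibres of surjective linear maps. -/

section Counting

variable {F : Type u} [Field F]

theorem card_fiber_of_surjective {V W : Type*} [AddCommGroup V] [Module F V] [Fintype V]
    [AddCommGroup W] [Module F W] [Fintype W] [DecidableEq W]
    (T : V →ₗ[F] W) (hT : Function.Surjective T) (w : W) :
    (Finset.univ.filter fun v => T v = w).card * Fintype.card W = Fintype.card V := by
  have h : ∀ w', (Finset.univ.filter fun v => T v = w').card
      = (Finset.univ.filter fun v => T v = w).card := fun w' =>
    AddMonoidHom.card_fiber_eq_of_mem_range T.toAddMonoidHom (hT w') (hT w)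
  have := Finset.card_eq_sum_card_fiberwise (f := T) (s := Finset.univ) (t := Finset.univ)
    (fun _ _ => Finset.mem_coe.2 (Finset.mem_univ _))
  rw [Finset.sum_congr rfl fun w' _ => h w', Finset.sum_const, Finset.card_univ,
    Finset.card_univ, smul_eq_mul] at this
  rw [this, mul_comm]

theorem sum_comp_of_surjective {V W : Type*} [AddCommGroup V] [Module F V] [Fintype V]
    [AddCommGroup W] [Module F W] [Fintype W] [DecidableEq W]
    (T : V →ₗ[F] W) (hT : Function.Surjective T) (φ : W → ℝ) :
    (∑ v, φ (T v)) * Fintype.card W = Fintype.card V * ∑ w, φ w := by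
  rw [← Finset.sum_fiberwise (s := Finset.univ) (g := T), Finset.sum_mul, Finset.mul_sum]
  refine Finset.sum_congr rfl fun w _ => ?_
  rw [Finset.sum_congr rfl (g := fun _ => φ w) (by simp +contextual), Finset.sum_const,
    ← card_fiber_of_surjective T hT w, nsmul_eq_mul]
  push_cast
  ring

end Counting

/-! ### Subpermanents as products of linear forms. -/

section SubPermanents

variable {F : Type u} [Field F] {ι : Type*} [DecidableEq ι]

/-- Multiplication of the square-free polynomial with coefficients `f` by the linear form with
coefficients `v`, as a linear function of `v`. -/
def mulLinearForm (f : Finset ι → F) : (ι → F) →ₗ[F] (Finset ι → F) where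
  toFun v S := ∑ i ∈ S, v i * f (S.erase i)
  map_add' v w := by
    ext S
    simp [add_mul, Finset.sum_add_distrib]
  map_smul' c v := by
    ext S
    simp [Finset.mul_sum, mul_assoc]

theorem mulLinearForm_apply (f : Finset ι → F) (v : ι → F) (S : Finset ι) :
    mulLinearForm f v S = ∑ i ∈ S, v i * f (S.erase i) := rfl

/-- The permanents of the `k × k` submatrices of a matrix with `k` rows,
indexed by sets of columns. -/
def subPermanent : (k : ℕ) → (Fin k → ι → F) → Finset ι → F
  | 0, _ => fun S => if S = ∅ then 1 else 0
  | k + 1, A => mulLinearForm (subPermanent k (Fin.tail A)) (A 0)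

theorem subPermanent_cons (k : ℕ) (v : ι → F) (A : Fin k → ι → F) :
    subPermanent (k + 1) (Fin.cons v A) = mulLinearForm (subPermanent k A) v := by
  simp [subPermanent]

theorem mulLinearForm_eq_zero_of_card_ne {k : ℕ} {f : Finset ι → F}
    (hf : ∀ S, S.card ≠ k → f S = 0) (v : ι → F) {S : Finset ι} (hS : S.card ≠ k + 1) :
    mulLinearForm f v S = 0 := by
  refine Finset.sum_eq_zero fun i hi => ?_
  rw [hf, mul_zero]
  have := Finset.card_erase_add_one hi
  omega

theorem subPermanent_eq_zero_of_card_ne (k : ℕ) (A : Fin k → ι → F) {S : Finset ι}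
    (hS : S.card ≠ k) : subPermanent k A S = 0 := by
  induction k generalizing S with
  | zero => simp_all [subPermanent]
  | succ k ih => exact mulLinearForm_eq_zero_of_card_ne (fun S hS => ih _ hS) _ hS

theorem subPermanent_eq_sum [Fintype ι] (k : ℕ) (A : Fin k → ι → F) (S : Finset ι) :
    subPermanent k A S = ∑ σ : Fin k → ι,
      if Function.Injective σ ∧ Finset.univ.image σ = S then ∏ i, A i (σ i) else 0 := by
  induction k generalizing S with
  | zero =>
    rw [Fintype.sum_unique]
    simp [subPermanent, Function.injective_of_subsingleton, eq_comm]
  | succ k ih =>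
    rw [subPermanent, mulLinearForm_apply, ← (Fin.consEquiv fun _ => ι).sum_comp,
      Fintype.sum_prod_type, ← Finset.sum_subset (Finset.subset_univ S)]
    · refine Finset.sum_congr rfl fun i hi => ?_
      rw [ih, Finset.mul_sum]
      refine Finset.sum_congr rfl fun σ _ => ?_
      simp only [Fin.consEquiv, Equiv.coe_fn_mk, Fin.cons_injective_iff, Fin.prod_univ_succ,
        Fin.cons_zero, Fin.cons_succ, mul_ite, mul_zero, Fin.tail]
      refine if_congr ?_ rfl rfl
      have : Finset.univ.image (Fin.cons i σ : Fin (k + 1) → ι)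
          = insert i (Finset.univ.image σ) := by
        ext j; simp [Fin.exists_fin_succ, eq_comm]
      rw [this]
      constructor
      · rintro ⟨h1, h2⟩
        refine ⟨⟨fun h => ?_, h1⟩, by rw [h2, Finset.insert_erase hi]⟩
        have : i ∈ Finset.univ.image σ := by simpa using h
        simp [h2] at this
      · rintro ⟨⟨h1, h2⟩, h3⟩
        refine ⟨h2, ?_⟩
        rw [← h3, Finset.erase_insert (by simpa using h1)]
    · intro i _ hi
      refine Finset.sum_eq_zero fun σ _ => if_neg ?_
      rintro ⟨-, rfl⟩
      exact hi (Finset.mem_image.2 ⟨0, by simp [Fin.consEquiv]⟩)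

theorem subPermanent_univ (n : ℕ) (A : Fin n → Fin n → F) :
    subPermanent n A Finset.univ = (Matrix.of A).permanent := by
  -- The transpose is needed because `Matrix.permanent` multiplies the entries `M (σ i) i`.
  rw [subPermanent_eq_sum, ← Matrix.permanent_transpose, Matrix.permanent, ← Finset.sum_filter]
  symm
  refine Finset.sum_bij (fun σ _ => σ) ?_ ?_ ?_ ?_
  · intro σ _
    simp [σ.injective, Finset.image_univ_of_surjective σ.surjective]
  · intro σ _ τ _ h
    exact DFunLike.coe_injective h
  · intro σ hσ
    refine ⟨Equiv.ofBijective σ (Finite.injective_iff_bijective.1 ?_), Finset.mem_univ _, rfl⟩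
    exact (Finset.mem_filter.1 hσ).2.1
  · intro σ _
    simp

theorem subPermanent_eq_zero_iff (n : ℕ) (A : Fin n → Fin n → F) :
    subPermanent n A = 0 ↔ (Matrix.of A).permanent = 0 := by
  rw [← subPermanent_univ]
  refine ⟨fun h => by rw [h]; rfl, fun h => funext fun S => ?_⟩
  by_cases hS : S.card = n
  · rw [(Finset.card_eq_iff_eq_univ S).1 (by simpa using hS), h]; rfl
  · exact subPermanent_eq_zero_of_card_ne n A hS

end SubPermanents

/-! ### Surjectivity of small linear systems. -/

section LinearSystems

variable {F : Type u} [Field F] {ι : Type*} [DecidableEq ι]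

theorem mulLinearForm_extend {κ : Type*} [Fintype κ] {x : κ → ι} (hx : Function.Injective x)
    (f : Finset ι → F) (y : κ → F) (U : Finset ι) :
    mulLinearForm f (Function.extend x y 0) U
      = ∑ l, if x l ∈ U then y l * f (U.erase (x l)) else 0 := by
  rw [mulLinearForm_apply, ← Finset.sum_filter]
  have : ∑ l ∈ Finset.univ.filter (fun l => x l ∈ U), y l * f (U.erase (x l))
      = ∑ i ∈ (Finset.univ.filter fun l => x l ∈ U).image x,
        Function.extend x y 0 i * f (U.erase i) := by
    rw [Finset.sum_image hx.injOn]
    simp [hx.extend_apply]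
  rw [this]
  symm
  refine Finset.sum_subset ?_ ?_
  · intro i hi
    obtain ⟨l, hl, rfl⟩ := Finset.mem_image.1 hi
    exact (Finset.mem_filter.1 hl).2
  · intro i hi hi'
    rw [Function.extend_apply', Pi.zero_apply, zero_mul]
    rintro ⟨l, rfl⟩
    exact hi' (Finset.mem_image.2 ⟨l, by simpa using hi, rfl⟩)

/-- Evaluation of `mulLinearForm` at a family of column sets. -/
def mulLinearFormAt {κ : Type*} (f : Finset ι → F) (U : κ → Finset ι) :
    (ι → F) →ₗ[F] (κ → F) :=
  LinearMap.funLeft F F U ∘ₗ mulLinearForm f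

theorem mulLinearFormAt_apply {κ : Type*} (f : Finset ι → F) (U : κ → Finset ι) (v : ι → F)
    (j : κ) : mulLinearFormAt f U v j = mulLinearForm f v (U j) := rfl

/-- Restricted to forms supported on the columns `x`, the system is `f S` times the identity. -/
theorem surjective_mulLinearFormAt_insert {κ : Type*} [Fintype κ] {x : κ → ι}
    (hx : Function.Injective x) {f : Finset ι → F} {S : Finset ι} (hS : f S ≠ 0)
    (hxS : ∀ j, x j ∉ S) :
    Function.Surjective (mulLinearFormAt f fun j => insert (x j) S) := by
  intro z
  refine ⟨Function.extend x (fun j => z j / f S) 0, funext fun j => ?_⟩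
  rw [mulLinearFormAt_apply, mulLinearForm_extend hx, Finset.sum_eq_single j]
  · rw [if_pos (Finset.mem_insert_self _ _), Finset.erase_insert (hxS j), div_mul_cancel₀ _ hS]
  · intro l _ hl
    rw [if_neg]
    simp [hx.eq_iff, hl, hxS l]
  · simp

/-- A symmetric `3 × 3` system with zero diagonal and non-zero other entries is invertible
in characteristic other than two. -/
theorem surjective_mulLinearFormAt_erase [Fintype ι] (h2 : (2 : F) ≠ 0) {x : Fin 3 → ι}
    (hx : Function.Injective x) {h : Finset ι → F}
    (h01 : h ((Finset.univ.erase (x 0)).erase (x 1)) ≠ 0)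
    (h02 : h ((Finset.univ.erase (x 0)).erase (x 2)) ≠ 0)
    (h12 : h ((Finset.univ.erase (x 1)).erase (x 2)) ≠ 0) :
    Function.Surjective (mulLinearFormAt h fun j => Finset.univ.erase (x j)) := by
  intro z
  obtain ⟨a, ha⟩ : ∃ a, a = h ((Finset.univ.erase (x 0)).erase (x 1)) := ⟨_, rfl⟩
  obtain ⟨b, hb⟩ : ∃ b, b = h ((Finset.univ.erase (x 0)).erase (x 2)) := ⟨_, rfl⟩
  obtain ⟨c, hc⟩ : ∃ c, c = h ((Finset.univ.erase (x 1)).erase (x 2)) := ⟨_, rfl⟩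
  have ha' : h ((Finset.univ.erase (x 1)).erase (x 0)) = a := by rw [Finset.erase_right_comm, ha]
  have hb' : h ((Finset.univ.erase (x 2)).erase (x 0)) = b := by rw [Finset.erase_right_comm, hb]
  have hc' : h ((Finset.univ.erase (x 2)).erase (x 1)) = c := by rw [Finset.erase_right_comm, hc]
  rw [← ha] at h01
  rw [← hb] at h02
  rw [← hc] at h12
  -- The inverse of the matrix with rows (0, a, b), (a, 0, c), (b, c, 0), applied to `z`.
  refine ⟨Function.extend x ![(b * z 1 + a * z 2 - c * z 0) / (2 * a * b),
    (c * z 0 + a * z 2 - b * z 1) / (2 * a * c),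
    (c * z 0 + b * z 1 - a * z 2) / (2 * b * c)] 0, funext fun j => ?_⟩
  rw [mulLinearFormAt_apply, mulLinearForm_extend hx, Fin.sum_univ_three]
  fin_cases j
  · simp [hx.eq_iff, ← ha, ← hb]
    field_simp
    ring
  · simp [hx.eq_iff, ha', ← hc]
    field_simp
    ring
  · simp [hx.eq_iff, hb', hc']
    field_simp
    ring

end LinearSystems

/-! ### Counting the annihilators of a form. -/

section KernelCounts

variable {F : Type u} [Field F] [Fintype F] [DecidableEq F]
  {ι : Type*} [DecidableEq ι] [Fintype ι]

/-- The number of linear forms annihilating `f`. -/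
def annihilatorCount (f : Finset ι → F) : ℕ :=
  (Finset.univ.filter fun v : ι → F => mulLinearForm f v = 0).card

theorem annihilatorCount_le (f : Finset ι → F) :
    annihilatorCount f ≤ Fintype.card F ^ Fintype.card ι :=
  (Finset.card_le_univ _).trans_eq Fintype.card_fun

theorem annihilatorCount_mul_le_of_surjective {κ : Type*} [Fintype κ] [DecidableEq κ]
    {f : Finset ι → F} {U : κ → Finset ι} (hU : Function.Surjective (mulLinearFormAt f U)) :
    annihilatorCount f * Fintype.card F ^ Fintype.card κ
      ≤ Fintype.card F ^ Fintype.card ι := by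
  have := card_fiber_of_surjective _ hU 0
  rw [Fintype.card_fun, Fintype.card_fun] at this
  rw [← this]
  refine Nat.mul_le_mul_right _ (Finset.card_le_card fun v hv => ?_)
  have hv' := (Finset.mem_filter.1 hv).2
  refine Finset.mem_filter.2 ⟨Finset.mem_univ _, funext fun j => ?_⟩
  rw [mulLinearFormAt_apply, hv']
  rfl

/-- Each column outside `S` contributes an independent linear condition. -/
theorem annihilatorCount_mul_le {f : Finset ι → F} {S : Finset ι} (hS : f S ≠ 0) {r : ℕ}
    (hr : S.card + r ≤ Fintype.card ι) :
    annihilatorCount f * Fintype.card F ^ r ≤ Fintype.card F ^ Fintype.card ι := by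
  have h := annihilatorCount_mul_le_of_surjective (surjective_mulLinearFormAt_insert
    (x := fun j : {i // i ∈ Sᶜ} => j.1) Subtype.val_injective hS
      fun j => Finset.mem_compl.1 j.2)
  refine le_trans (Nat.mul_le_mul_left _ (Nat.pow_le_pow_right Fintype.card_pos ?_)) h
  rw [Fintype.card_coe, Finset.card_compl]
  omega

theorem annihilatorCount_mul_le_of_ne_zero {k r : ℕ} {f : Finset ι → F}
    (hf : ∀ S, S.card ≠ k → f S = 0) (hf0 : f ≠ 0) (hr : k + r ≤ Fintype.card ι) :
    annihilatorCount f * Fintype.card F ^ r ≤ Fintype.card F ^ Fintype.card ι := by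
  obtain ⟨S, hS⟩ := Function.ne_iff.1 hf0
  have : S.card = k := by
    by_contra h
    exact hS (hf S h)
  exact annihilatorCount_mul_le hS (by omega)

/-- A bound, up to a power of the order of the field, for the number of linear forms annihilating
a quadratic square-free form in which the monomials in three given variables have the
coefficients `y`. -/
noncomputable def kernelWeight (y : Fin 3 → F) : ℝ :=
  if y = 0 then (Fintype.card F : ℝ) ^ 3
  else if ∀ j, y j ≠ 0 then 1 else (Fintype.card F : ℝ)

theorem sum_kernelWeight :
    ∑ y : Fin 3 → F, kernelWeight y = (Fintype.card F : ℝ) ^ 4 + (Fintype.card F : ℝ) ^ 3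
      - Fintype.card F - ((Fintype.card F : ℝ) - 1) ^ 4 := by
  -- The constant q, corrected at the zero vector and at vectors without zero entries.
  have key : ∀ y : Fin 3 → F, kernelWeight y = (Fintype.card F : ℝ)
      + (if y = 0 then (Fintype.card F : ℝ) ^ 3 - Fintype.card F else 0)
      + (if ∀ j, y j ≠ 0 then 1 - (Fintype.card F : ℝ) else 0) := by
    intro y
    unfold kernelWeight
    by_cases h0 : y = 0
    · simp [h0]
    · by_cases h1 : ∀ j, y j ≠ 0
      · rw [if_neg h0, if_pos h1, if_neg h0, if_pos h1]; ring
      · rw [if_neg h0, if_neg h1, if_neg h0, if_neg h1]; ring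
  have hcard : (Finset.univ.filter fun y : Fin 3 → F => ∀ j, y j ≠ 0).card
      = (Fintype.card F - 1) ^ 3 := by
    have : (Finset.univ.filter fun y : Fin 3 → F => ∀ j, y j ≠ 0)
        = Fintype.piFinset fun _ => Finset.univ.erase (0 : F) := by
      ext y; simp [Fintype.mem_piFinset]
    rw [this, Fintype.card_piFinset]
    simp [Finset.card_erase_of_mem]
  rw [Finset.sum_congr rfl fun y _ => key y, Finset.sum_add_distrib, Finset.sum_add_distrib,
    Finset.sum_ite_eq', if_pos (Finset.mem_univ _), ← Finset.sum_filter, Finset.sum_const,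
    Finset.sum_const, hcard, Finset.card_univ, Fintype.card_fun, Fintype.card_fin, nsmul_eq_mul,
    nsmul_eq_mul]
  push_cast [Nat.cast_sub (Fintype.card_pos (α := F))]
  ring

/-- Let `f S ≠ 0`. The three coefficients of the product of `f` and `v` at `S` plus one column are
equidistributed over F³ as `v` varies. The number of annihilators of that product is bounded through
these coefficients alone, so averaging reduces to `sum_kernelWeight`. -/
theorem sum_annihilatorCount_mulLinearForm_le (h2 : (2 : F) ≠ 0) {k : ℕ}
    (hk : k + 3 = Fintype.card ι) {f : Finset ι → F} (hf : ∀ S, S.card ≠ k → f S = 0)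
    (hf0 : f ≠ 0) :
    (∑ v : ι → F, (annihilatorCount (mulLinearForm f v) : ℝ)) * (Fintype.card F : ℝ) ^ 6
      ≤ (Fintype.card F : ℝ) ^ (2 * Fintype.card ι) *
        ((Fintype.card F : ℝ) ^ 4 + (Fintype.card F : ℝ) ^ 3
          - Fintype.card F - ((Fintype.card F : ℝ) - 1) ^ 4) := by
  obtain ⟨S, hS⟩ := Function.ne_iff.1 hf0
  have hSk : S.card = k := by
    by_contra h
    exact hS (hf S h)
  have hSc : Sᶜ.card = 3 := by rw [Finset.card_compl]; omega
  obtain ⟨e⟩ : Nonempty ({i // i ∈ Sᶜ} ≃ Fin 3) := ⟨Finset.equivFinOfCardEq hSc⟩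
  obtain ⟨x, hxdef⟩ : ∃ x : Fin 3 → ι, ∀ j, x j = (e.symm j).1 := ⟨_, fun _ => rfl⟩
  have hx : Function.Injective x := fun i j h => by
    rw [hxdef, hxdef] at h
    exact e.symm.injective (Subtype.ext h)
  have hxS : ∀ j, x j ∉ S := fun j => by
    rw [hxdef]; exact Finset.mem_compl.1 (e.symm j).2
  have hSx : ∀ i, i ∉ S → ∃ j, i = x j := fun i hi =>
    ⟨e ⟨i, Finset.mem_compl.2 hi⟩, by rw [hxdef]; simp⟩
  -- Thus the off-diagonal entries of the 3 × 3 system are exactly those three coefficients.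
  have herase : ∀ j l m : Fin 3, j ≠ l → j ≠ m → l ≠ m →
      (Finset.univ.erase (x j)).erase (x l) = insert (x m) S := by
    intro j l m hjl hjm hlm
    ext i
    simp only [Finset.mem_erase, Finset.mem_univ, and_true, Finset.mem_insert]
    by_cases hi : i ∈ S
    · have : ∀ p, i ≠ x p := fun p hp => hxS p (hp ▸ hi)
      simp [hi, this]
    · obtain ⟨p, rfl⟩ := hSx i hi
      simp only [ne_eq, hx.eq_iff, hi, or_false]
      omega
  have hT := surjective_mulLinearFormAt_insert hx hS hxS
  have hpoint : ∀ v : ι → F,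
      (annihilatorCount (mulLinearForm f v) : ℝ) * (Fintype.card F : ℝ) ^ 3
        ≤ (Fintype.card F : ℝ) ^ Fintype.card ι
          * kernelWeight (mulLinearFormAt f (fun j => insert (x j) S) v) := by
    intro v
    have hQ : (0 : ℝ) < Fintype.card F := by exact_mod_cast Fintype.card_pos
    unfold kernelWeight
    split_ifs with h0 h1
    · have := annihilatorCount_le (mulLinearForm f v)
      gcongr
      exact_mod_cast this
    · have := annihilatorCount_mul_le_of_surjective (surjective_mulLinearFormAt_erase h2 hx
        (h := mulLinearForm f v)
        (by rw [herase 0 1 2 (by decide) (by decide) (by decide)]; exact h1 2)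
        (by rw [herase 0 2 1 (by decide) (by decide) (by decide)]; exact h1 1)
        (by rw [herase 1 2 0 (by decide) (by decide) (by decide)]; exact h1 0))
      rw [Fintype.card_fin] at this
      rw [mul_one]
      exact_mod_cast this
    · obtain ⟨j, hj⟩ := Function.ne_iff.1 h0
      have := annihilatorCount_mul_le (f := mulLinearForm f v) (S := insert (x j) S) (r := 2) hj
        (by rw [Finset.card_insert_of_notMem (hxS j)]; omega)
      rw [pow_succ _ 2, ← mul_assoc]
      gcongr
      exact_mod_cast this
  have hsum := sum_comp_of_surjective _ hT kernelWeight
  rw [sum_kernelWeight, Fintype.card_fun, Fintype.card_fun, Fintype.card_fin] at hsum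
  push_cast at hsum
  have h1 := Finset.sum_le_sum fun v (_ : v ∈ Finset.univ) => hpoint v
  rw [← Finset.sum_mul, ← Finset.mul_sum] at h1
  calc _ = (∑ v : ι → F, (annihilatorCount (mulLinearForm f v) : ℝ)) * (Fintype.card F : ℝ) ^ 3
        * (Fintype.card F : ℝ) ^ 3 := by ring
    _ ≤ _ := mul_le_mul_of_nonneg_right h1 (by positivity)
    _ = _ := by rw [mul_assoc, hsum]; ring

end KernelCounts

/-! ### Counting matrices with vanishing product of rows. -/

section ZeroCounts

variable (F : Type u) [Field F] [Fintype F] [DecidableEq F] (n : ℕ)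

/-- The number of `k × n` matrices all of whose permanental `k`-minors vanish. -/
def zeroCount (k : ℕ) : ℕ :=
  (Finset.univ.filter fun A : Fin k → Fin n → F => subPermanent k A = 0).card

theorem zeroCount_succ (k : ℕ) :
    zeroCount F n (k + 1) = ∑ A : Fin k → Fin n → F, annihilatorCount (subPermanent k A) := by
  simp only [zeroCount, annihilatorCount, Finset.card_filter]
  rw [← (Fin.consEquiv fun _ => Fin n → F).sum_comp, Fintype.sum_prod_type_right]
  simp [Fin.consEquiv, subPermanent_cons]

theorem zeroCount_add_two (k : ℕ) :
    zeroCount F n (k + 2) = ∑ A : Fin k → Fin n → F, ∑ v : Fin n → F,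
      annihilatorCount (mulLinearForm (subPermanent k A) v) := by
  rw [zeroCount_succ, ← (Fin.consEquiv fun _ => Fin n → F).sum_comp, Fintype.sum_prod_type_right]
  simp [Fin.consEquiv, subPermanent_cons]

variable {F n}

/-- Here `b` is the generic bound and `a` the extra cost paid only where the product vanishes. -/
theorem sum_le_of_subPermanent_ne_zero {k : ℕ} {φ : (Fin k → Fin n → F) → ℝ} {a b : ℝ}
    (hb : ∀ A, subPermanent k A ≠ 0 → φ A ≤ b) (ha : ∀ A, φ A ≤ a + b) :
    ∑ A, φ A ≤ (Fintype.card F : ℝ) ^ (n * k) * b + zeroCount F n k * a := by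
  calc ∑ A, φ A ≤ ∑ A : Fin k → Fin n → F, (b + if subPermanent k A = 0 then a else 0) := by
        refine Finset.sum_le_sum fun A _ => ?_
        split_ifs with h
        · linarith [ha A]
        · linarith [hb A h]
    _ = _ := by
        rw [Finset.sum_add_distrib, Finset.sum_const, ← Finset.sum_filter, Finset.sum_const,
          Finset.card_univ, Fintype.card_fun, Fintype.card_fun, Fintype.card_fin,
          Fintype.card_fin, nsmul_eq_mul, nsmul_eq_mul, zeroCount, ← pow_mul]
        push_cast
        rfl

/-- While at least three columns are unused, a new row kills a nonzero product with probability at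
most q⁻³; the bound adds this up over the `k` rows. -/
theorem zeroCount_mul_le {k : ℕ} (hk : k + 2 ≤ n) :
    (zeroCount F n k : ℝ) * (Fintype.card F : ℝ) ^ 3 ≤ k * (Fintype.card F : ℝ) ^ (n * k) := by
  have hQ : (0 : ℝ) < Fintype.card F := by exact_mod_cast Fintype.card_pos
  induction k with
  | zero =>
    have : zeroCount F n 0 = 0 := by
      refine Finset.card_eq_zero.2 (Finset.filter_eq_empty_iff.2 fun A _ h => ?_)
      simpa [subPermanent] using congrFun h ∅
    simp [this]
  | succ k ih =>
    have h := sum_le_of_subPermanent_ne_zero (F := F) (n := n) (k := k)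
      (φ := fun A => (annihilatorCount (subPermanent k A) : ℝ) * (Fintype.card F : ℝ) ^ 3)
      (a := (Fintype.card F : ℝ) ^ n * (Fintype.card F : ℝ) ^ 3)
      (b := (Fintype.card F : ℝ) ^ n)
      (fun A hA => by
        have := annihilatorCount_mul_le_of_ne_zero (k := k) (r := 3)
          (fun S hS => subPermanent_eq_zero_of_card_ne k A hS) hA (by simp; omega)
        rw [Fintype.card_fin] at this
        exact_mod_cast this)
      (fun A => by
        have := annihilatorCount_le (subPermanent k A)
        rw [Fintype.card_fin] at this
        have h1 : (annihilatorCount (subPermanent k A) : ℝ) ≤ (Fintype.card F : ℝ) ^ n := by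
          exact_mod_cast this
        have := mul_le_mul_of_nonneg_right h1 (by positivity : 0 ≤ (Fintype.card F : ℝ) ^ 3)
        have : 0 < (Fintype.card F : ℝ) ^ n := by positivity
        linarith)
    rw [← Finset.sum_mul] at h
    rw [zeroCount_succ]
    push_cast
    refine h.trans ?_
    have := mul_le_mul_of_nonneg_left (ih (by omega))
      (by positivity : 0 ≤ (Fintype.card F : ℝ) ^ n)
    rw [mul_add_one n k, pow_add]
    linarith

theorem zeroCount_penultimate_le (h2 : (2 : F) ≠ 0) (m : ℕ) :
    (zeroCount F (m + 3) (m + 2) : ℝ) * (Fintype.card F : ℝ) ^ 6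
      ≤ (Fintype.card F : ℝ) ^ ((m + 3) * (m + 2)) * ((Fintype.card F : ℝ) ^ 4
        + (m + 1) * (Fintype.card F : ℝ) ^ 3 - Fintype.card F
        - ((Fintype.card F : ℝ) - 1) ^ 4) := by
  have hQ : (1 : ℝ) ≤ Fintype.card F := by exact_mod_cast Fintype.card_pos (α := F)
  have hN : 0 ≤ (Fintype.card F : ℝ) ^ 4 + (Fintype.card F : ℝ) ^ 3
      - Fintype.card F - ((Fintype.card F : ℝ) - 1) ^ 4 := by
    rw [← sum_kernelWeight]
    refine Finset.sum_nonneg fun y _ => ?_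
    unfold kernelWeight
    split_ifs <;> positivity
  have h := sum_le_of_subPermanent_ne_zero (F := F) (n := m + 3) (k := m)
    (φ := fun A => (∑ v : Fin (m + 3) → F,
      (annihilatorCount (mulLinearForm (subPermanent m A) v) : ℝ)) * (Fintype.card F : ℝ) ^ 6)
    (a := (Fintype.card F : ℝ) ^ (2 * (m + 3)) * (Fintype.card F : ℝ) ^ 6)
    (b := (Fintype.card F : ℝ) ^ (2 * (m + 3)) * ((Fintype.card F : ℝ) ^ 4
      + (Fintype.card F : ℝ) ^ 3 - Fintype.card F - ((Fintype.card F : ℝ) - 1) ^ 4))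
    (fun A hA => by
      have := sum_annihilatorCount_mulLinearForm_le h2 (k := m) (by simp)
        (fun S hS => subPermanent_eq_zero_of_card_ne m A hS) hA
      rwa [Fintype.card_fin] at this)
    (fun A => by
      have h1 : ∑ v : Fin (m + 3) → F,
          (annihilatorCount (mulLinearForm (subPermanent m A) v) : ℝ)
            ≤ (Fintype.card F : ℝ) ^ (2 * (m + 3)) := by
        refine (Finset.sum_le_sum (g := fun _ => (Fintype.card F : ℝ) ^ (m + 3))
          fun v _ => ?_).trans_eq ?_
        · have := annihilatorCount_le (mulLinearForm (subPermanent m A) v)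
          rw [Fintype.card_fin] at this
          exact_mod_cast this
        · rw [Finset.sum_const, Finset.card_univ, Fintype.card_fun, Fintype.card_fin,
            nsmul_eq_mul]
          push_cast
          ring
      have := mul_le_mul_of_nonneg_right h1 (by positivity : 0 ≤ (Fintype.card F : ℝ) ^ 6)
      have := mul_nonneg (by positivity : 0 ≤ (Fintype.card F : ℝ) ^ (2 * (m + 3))) hN
      linarith)
  rw [← Finset.sum_mul] at h
  rw [zeroCount_add_two]
  push_cast
  refine h.trans ?_
  have := mul_le_mul_of_nonneg_left (zeroCount_mul_le (F := F) (n := m + 3) (k := m) (by omega))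
    (by positivity : 0 ≤ (Fintype.card F : ℝ) ^ (2 * (m + 3)) * (Fintype.card F : ℝ) ^ 3)
  have e : (m + 3) * (m + 2) = 2 * (m + 3) + (m + 3) * m := by ring
  rw [e, pow_add]
  nlinarith [this]

theorem zeroCount_square_le (h2 : (2 : F) ≠ 0) (m : ℕ) :
    (zeroCount F (m + 3) (m + 3) : ℝ) * (Fintype.card F : ℝ) ^ 7
      ≤ (Fintype.card F : ℝ) ^ ((m + 3) * (m + 3)) * ((Fintype.card F : ℝ) ^ 6
        + ((Fintype.card F : ℝ) - 1) * ((Fintype.card F : ℝ) ^ 4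
        + (m + 1) * (Fintype.card F : ℝ) ^ 3 - Fintype.card F
        - ((Fintype.card F : ℝ) - 1) ^ 4)) := by
  have hQ : (1 : ℝ) ≤ Fintype.card F := by exact_mod_cast Fintype.card_pos (α := F)
  have h := sum_le_of_subPermanent_ne_zero (F := F) (n := m + 3) (k := m + 2)
    (φ := fun A => (annihilatorCount (subPermanent (m + 2) A) : ℝ) * (Fintype.card F : ℝ))
    (a := (Fintype.card F : ℝ) ^ (m + 3) * ((Fintype.card F : ℝ) - 1))
    (b := (Fintype.card F : ℝ) ^ (m + 3))
    (fun A hA => by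
      have := annihilatorCount_mul_le_of_ne_zero (k := m + 2) (r := 1)
        (fun S hS => subPermanent_eq_zero_of_card_ne (m + 2) A hS) hA (by simp)
      rw [Fintype.card_fin, pow_one] at this
      exact_mod_cast this)
    (fun A => by
      have := annihilatorCount_le (subPermanent (m + 2) A)
      rw [Fintype.card_fin] at this
      have h1 : (annihilatorCount (subPermanent (m + 2) A) : ℝ)
          ≤ (Fintype.card F : ℝ) ^ (m + 3) := by
        exact_mod_cast this
      have := mul_le_mul_of_nonneg_right h1 (by positivity : 0 ≤ (Fintype.card F : ℝ))
      linarith)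
  rw [← Finset.sum_mul] at h
  have h0 : (zeroCount F (m + 3) (m + 3) : ℝ) * Fintype.card F
      ≤ (Fintype.card F : ℝ) ^ (m + 3) * ((Fintype.card F : ℝ) ^ ((m + 3) * (m + 2))
        + ((Fintype.card F : ℝ) - 1) * zeroCount F (m + 3) (m + 2)) := by
    rw [zeroCount_succ]
    push_cast
    refine h.trans_eq (by ring)
  have h1 := mul_le_mul_of_nonneg_left (zeroCount_penultimate_le h2 m)
    (mul_nonneg (by positivity) (by linarith) :
      0 ≤ (Fintype.card F : ℝ) ^ (m + 3) * ((Fintype.card F : ℝ) - 1))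
  have h3 := mul_le_mul_of_nonneg_right h0 (by positivity : 0 ≤ (Fintype.card F : ℝ) ^ 6)
  have e : (m + 3) * (m + 3) = (m + 3) + (m + 3) * (m + 2) := by ring
  rw [e, pow_add _ (m + 3)]
  linarith

end ZeroCounts
-- Comparison with singular matrices.
section Comparison

variable {F : Type u} [Field F] [Fintype F]

theorem ncard_zeroPermanent [DecidableEq F] (n : ℕ) :
    (zeroPermanent n F).ncard = zeroCount F n n := by
  rw [zeroCount, ← Set.ncard_coe_finset]
  have h (A : Fin n → Fin n → F) : Matrix.of A ∈ zeroPermanent n F ↔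
      A ∈ (Finset.univ.filter fun A : Fin n → Fin n → F => subPermanent n A = 0) := by
    rw [Finset.mem_filter, subPermanent_eq_zero_iff]
    exact (and_iff_right (Finset.mem_univ _)).symm
  exact congrArg Set.ncard (Set.ext h)

theorem ncard_zeroDeterminant_add (n : ℕ) :
    (zeroDeterminant n F).ncard + ∏ i : Fin n, (Fintype.card F ^ n - Fintype.card F ^ (i : ℕ))
      = Fintype.card F ^ (n * n) := by
  classical
  have hGL : (zeroDeterminant n F)ᶜ.ncard
      = ∏ i : Fin n, (Fintype.card F ^ n - Fintype.card F ^ (i : ℕ)) := by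
    rw [← Matrix.card_GL_field, ← Set.ncard_univ, ← Set.ncard_image_of_injective _
      (Units.val_injective : Function.Injective fun g : GL (Fin n) F =>
        (g : Matrix (Fin n) (Fin n) F)), Set.image_univ]
    congr 1
    ext A
    have : A ∈ Set.range (fun g : GL (Fin n) F => (g : Matrix (Fin n) (Fin n) F)) ↔ IsUnit A :=
      Iff.rfl
    rw [this, Matrix.isUnit_iff_isUnit_det, isUnit_iff_ne_zero]
    rfl
  rw [← hGL, Set.ncard_add_ncard_compl, Nat.card_eq_fintype_card]
  change Fintype.card (Fin n → Fin n → F) = _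
  rw [Fintype.card_fun, Fintype.card_fun, Fintype.card_fin, pow_mul]

/-- In the order of GL, all factors but the last three are bounded by q^(m+3). -/
theorem le_ncard_zeroDeterminant (m : ℕ) :
    (Fintype.card F : ℝ) ^ ((m + 3) * (m + 3)) * ((Fintype.card F : ℝ) ^ 6
        - ((Fintype.card F : ℝ) - 1) * ((Fintype.card F : ℝ) ^ 2 - 1)
          * ((Fintype.card F : ℝ) ^ 3 - 1))
      ≤ (zeroDeterminant (m + 3) F).ncard * (Fintype.card F : ℝ) ^ 6 := by
  have hQ : (1 : ℝ) ≤ Fintype.card F := by exact_mod_cast Fintype.card_pos (α := F)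
  have h : ((zeroDeterminant (m + 3) F).ncard : ℝ) + ∏ i : Fin (m + 3),
      ((Fintype.card F : ℝ) ^ (m + 3) - (Fintype.card F : ℝ) ^ (i : ℕ))
      = (Fintype.card F : ℝ) ^ ((m + 3) * (m + 3)) := by
    have := congrArg (Nat.cast : ℕ → ℝ) (ncard_zeroDeterminant_add (F := F) (m + 3))
    push_cast at this
    rw [← this]
    congr 1
    refine Finset.prod_congr rfl fun i _ => ?_
    rw [Nat.cast_sub (Nat.pow_le_pow_right Fintype.card_pos i.2.le)]
    push_cast
    rfl
  have hle : ∀ i, i < m + 3 →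
      0 ≤ (Fintype.card F : ℝ) ^ (m + 3) - (Fintype.card F : ℝ) ^ i := fun i hi =>
    sub_nonneg.2 (pow_le_pow_right₀ hQ hi.le)
  have hprod : ∏ i ∈ Finset.range m, ((Fintype.card F : ℝ) ^ (m + 3) - (Fintype.card F : ℝ) ^ i)
      ≤ ((Fintype.card F : ℝ) ^ (m + 3)) ^ m := by
    rw [← Finset.card_range m, ← Finset.prod_const, Finset.card_range]
    refine Finset.prod_le_prod (fun i hi => hle i ?_) fun i _ => sub_le_self _ (by positivity)
    have := Finset.mem_range.1 hi
    omega
  rw [Fin.prod_univ_eq_prod_range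
    (fun i => (Fintype.card F : ℝ) ^ (m + 3) - (Fintype.card F : ℝ) ^ i),
    Finset.prod_range_succ, Finset.prod_range_succ, Finset.prod_range_succ] at h
  have h1 := mul_le_mul_of_nonneg_right hprod (mul_nonneg (mul_nonneg (mul_nonneg
    (hle m (by omega)) (hle (m + 1) (by omega))) (hle (m + 2) (by omega)))
    (by positivity : 0 ≤ (Fintype.card F : ℝ) ^ 6))
  have e : (m + 3) * (m + 3) = (m + 3) * m + 3 * m + 9 := by ring
  have h2 : ((Fintype.card F : ℝ) ^ (m + 3)) ^ m
      * (((Fintype.card F : ℝ) ^ (m + 3) - (Fintype.card F : ℝ) ^ m)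
      * ((Fintype.card F : ℝ) ^ (m + 3) - (Fintype.card F : ℝ) ^ (m + 1))
      * ((Fintype.card F : ℝ) ^ (m + 3) - (Fintype.card F : ℝ) ^ (m + 2))
      * (Fintype.card F : ℝ) ^ 6)
      = (Fintype.card F : ℝ) ^ ((m + 3) * (m + 3)) * (((Fintype.card F : ℝ) - 1)
        * ((Fintype.card F : ℝ) ^ 2 - 1) * ((Fintype.card F : ℝ) ^ 3 - 1)) := by
    rw [e]
    ring
  rw [h2] at h1
  rw [eq_sub_of_add_eq h]
  linarith

/-- After scaling by q⁷, the two bounds differ by exactly q^((m+3)²)(q − 1)((q − 1)⁴ − mq³), so `hm`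
says that this is positive. -/
theorem ncard_zeroPermanent_lt (h2 : (2 : F) ≠ 0) {m : ℕ}
    (hm : (m : ℝ) * (Fintype.card F : ℝ) ^ 3 < ((Fintype.card F : ℝ) - 1) ^ 4) :
    (zeroPermanent (m + 3) F).ncard < (zeroDeterminant (m + 3) F).ncard := by
  classical
  have hQ : (1 : ℝ) < Fintype.card F := by exact_mod_cast Fintype.one_lt_card (α := F)
  have hP := zeroCount_square_le h2 m
  rw [← ncard_zeroPermanent] at hP
  have hD := mul_le_mul_of_nonneg_right (le_ncard_zeroDeterminant (F := F) m)
    (zero_le_one.trans hQ.le)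
  have hpos : 0 < (Fintype.card F : ℝ) ^ ((m + 3) * (m + 3)) := by positivity
  have key := mul_pos hpos (mul_pos (sub_pos.2 hQ) (sub_pos.2 hm))
  have : ((zeroPermanent (m + 3) F).ncard : ℝ) * (Fintype.card F : ℝ) ^ 7
      < (zeroDeterminant (m + 3) F).ncard * (Fintype.card F : ℝ) ^ 7 := by
    linarith
  exact_mod_cast lt_of_mul_lt_mul_right this (by positivity)

omit [Fintype F] in
theorem not_exists_bijective_permanent_eq_det {n : ℕ}
    (h : (zeroPermanent n F).ncard < (zeroDeterminant n F).ncard) :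
    ¬ ∃ Φ : Matrix (Fin n) (Fin n) F → Matrix (Fin n) (Fin n) F,
      Function.Bijective Φ ∧ ∀ A, A.permanent = (Φ A).det := by
  rintro ⟨Φ, hΦ, hdet⟩
  have : Φ ⁻¹' zeroDeterminant n F = zeroPermanent n F :=
    Set.ext fun A => by simp [zeroDeterminant, zeroPermanent, hdet]
  rw [← Set.image_preimage_eq (zeroDeterminant n F) hΦ.surjective, this,
    Set.ncard_image_of_injective _ hΦ.injective] at h
  exact h.false

end Comparison

theorem mainTheorem1 :
    (∀ n : ℕ, 3 ≤ n → ∃ q₀ : ℕ, ∀ (F : Type u) [Field F] [Finite F],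
      ringChar F ≠ 2 → q₀ ≤ Nat.card F →
        (¬ ∃ Φ : Matrix (Fin n) (Fin n) F → Matrix (Fin n) (Fin n) F,
          Function.Bijective Φ ∧ ∀ A, A.permanent = (Φ A).det) ∧
        (zeroPermanent n F).ncard < (zeroDeterminant n F).ncard) ∧
    (∀ (F : Type u) [Field F] [Finite F], ringChar F ≠ 2 →
        (¬ ∃ Φ : Matrix (Fin 3) (Fin 3) F → Matrix (Fin 3) (Fin 3) F,
          Function.Bijective Φ ∧ ∀ A, A.permanent = (Φ A).det) ∧
        (zeroPermanent 3 F).ncard < (zeroDeterminant 3 F).ncard) := by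
  constructor
  · intro n hn
    obtain ⟨m, rfl⟩ := Nat.exists_eq_add_of_le' hn
    -- For q ≥ m + 5, mq³ ≤ q⁴ − 5q³, which is below (q − 1)⁴ = q⁴ − 4q³ + 6q² − 4q + 1.
    refine ⟨m + 5, fun F _ _ h2 hq => ?_⟩
    have := Fintype.ofFinite F
    have hlt : (zeroPermanent (m + 3) F).ncard < (zeroDeterminant (m + 3) F).ncard := by
      refine ncard_zeroPermanent_lt (Ring.two_ne_zero h2) ?_
      rw [Nat.card_eq_fintype_card] at hq
      have hq' : (m : ℝ) + 5 ≤ Fintype.card F := by exact_mod_cast hq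
      have hm : (0 : ℝ) ≤ m := m.cast_nonneg
      have h3 : (m : ℝ) * (Fintype.card F : ℝ) ^ 3
          ≤ ((Fintype.card F : ℝ) - 5) * (Fintype.card F : ℝ) ^ 3 :=
        mul_le_mul_of_nonneg_right (by linarith) (by positivity)
      have h4 : 0 < (Fintype.card F : ℝ) ^ 3 := by positivity
      have h5 : 0 ≤ (Fintype.card F : ℝ) * ((Fintype.card F : ℝ) - 5) :=
        mul_nonneg (by linarith) (by linarith)
      linarith
    exact ⟨not_exists_bijective_permanent_eq_det hlt, hlt⟩
  · intro F _ _ h2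
    have := Fintype.ofFinite F
    have hlt : (zeroPermanent 3 F).ncard < (zeroDeterminant 3 F).ncard := by
      -- With m = 0 the condition is just (q − 1)⁴ > 0, so no lower bound on q is needed.
      refine ncard_zeroPermanent_lt (m := 0) (Ring.two_ne_zero h2) ?_
      have hQ : (1 : ℝ) < Fintype.card F := by exact_mod_cast Fintype.one_lt_card (α := F)
      rw [Nat.cast_zero, zero_mul]
      exact pow_pos (sub_pos.2 hQ) 4
    exact ⟨not_exists_bijective_permanent_eq_det hlt, hlt⟩
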